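/- **Theorem (Stability of the BE-EEV scheme).** Let $d\in\{2,3\}$ and let $\mathcal D\subset\mathbb R^d$ be a bounded open set (for example a convex polygonal or polyhedral domain). Write $\|\cdot\|$, $(\cdot,\cdot)$ for the $L^2(\mathcal D)$ norm and inner product. Let $\boldsymbol X=\boldsymbol H^1_0(\mathcal D)$ be the closure of $C_c^\infty(\mathcal D)^d$ in the $H^1$ norm, $Q=L^2_0(\mathcal D)=\{q\in L^2(\mathcal D):\int_{\mathcal D}q\,dx=0\}$, $\boldsymbol V=\{\boldsymbol v\in\boldsymbol X:(\nabla\cdot\boldsymbol v,q)=0\ \forall q\in Q\}$, $\boldsymbol H^{-1}(\mathcal D)=\boldsymbol X^*$ with $\|\boldsymbol g\|_{-1}=\sup_{0\ne\boldsymbol v\in\boldsymbol X}|\langle\boldsymbol g,\boldsymbol v\rangle|/\|\nabla\boldsymbol v\|$, and $$b^*(\boldsymbol u,\boldsymbol v,\boldsymbol w)=\tfrac12(\boldsymbol u\cdot\nabla\boldsymbol v,\boldsymbol w)-\tfrac12(\boldsymbol u\cdot\nabla\boldsymbol w,\boldsymbol v).$$ There is a constant $C>0$, depending only on $\mathcal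 D$, such that the following holds. Let $\nu_1,\dots,\nu_J\in L^\infty(\mathcal D)$, $\bar\nu=\frac1J\sum_{j=1}^J\nu_j$, $\nu_j'=\nu_j-\bar\nu$, $\bar\nu_{\min}=\operatorname{ess\,inf}_{\mathcal D}\bar\nu$, and assume $$\alpha_j:=\bar\nu_{\min}-\|\nu_j'\|_{L^\infty}>0\qquad(j=1,\dots,J).$$ Let $T,\Delta t>0$ and $M\in\mathbb N$ with $M\Delta t=T$, $t_n=n\Delta t$, $\gamma>0$, $\mu\ge\frac12$, and $\boldsymbol f_j\in L^\infty(0,T;\boldsymbol H^{-1}(\mathcal D))$, given as functions defined at every time. Let $\boldsymbol X_h\subset\boldsymbol X$ and $Q_h\subset Q$ be finite-dimensional subspaces such that every element of $\boldsymbol X_h$ is essentially bounded with essentially bounded gradient (for example, any conforming finite element spaces). Let $\boldsymbol u_{j,h}^0\in\boldsymbol V$ (for example $\boldsymbol u_{j,h}^0\in\boldsymbol H^2(\mathcal D)\cap\boldsymbol V$), and for $j=1,\dots,J$ and $n=0,\dots,M-1$ let $(\boldsymbol u_{j,h}^{n+1},p_{j,h}^{n+1})\in\boldsymbol X_h\times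 Q_h$ satisfy, for all $(\boldsymbol\chi_h,q_h)\in\boldsymbol X_h\times Q_h$, $$\begin{aligned}&\tfrac1{\Delta t}(\boldsymbol u_{j,h}^{n+1},\boldsymbol\chi_h)+b^*(\langle\boldsymbol u_h\rangle^n,\boldsymbol u_{j,h}^{n+1},\boldsymbol\chi_h)+(\bar\nu\nabla\boldsymbol u_{j,h}^{n+1},\nabla\boldsymbol\chi_h)+(\gamma\nabla\cdot\boldsymbol u_{j,h}^{n+1}-p_{j,h}^{n+1},\nabla\cdot\boldsymbol\chi_h)+(2\nu_T^{h}\nabla\boldsymbol u_{j,h}^{n+1},\nabla\boldsymbol\chi_h)\\&\quad=\langle\boldsymbol f_j(t_{n+1}),\boldsymbol\chi_h\rangle+\tfrac1{\Delta t}(\boldsymbol u_{j,h}^{n},\boldsymbol\chi_h)-b^*(\boldsymbol u_{j,h}'^{\,n},\boldsymbol u_{j,h}^n,\boldsymbol\chi_h)-(\nu_j'\nabla\boldsymbol u_{j,h}^n,\nabla\boldsymbol\chi_h),\\&(\nabla\cdot\boldsymbol u_{j,h}^{n+1},q_h)=0,\end{aligned}$$ where $\langle\boldsymbol u_h\rangle^n=\frac1J\sum_{j=1}^J\boldsymbol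 u_{j,h}^n$, $\boldsymbol u_{j,h}'^{\,n}=\boldsymbol u_{j,h}^n-\langle\boldsymbol u_h\rangle^n$, $\nu_T^h=\mu\,\Delta t\,(l_h^n)^2$ and $l_h^n=\big(\sum_{j=1}^J|\boldsymbol u_{j,h}'^{\,n}|^2\big)^{1/2}$. Assume $$\Delta t\,\|\nabla\cdot\boldsymbol u_{j,h}'^{\,n}\|_{L^\infty}^2\le C\alpha_j\qquad(1\le j\le J,\ 1\le n\le M).$$ Then, for every $j=1,\dots,J$, $$\|\boldsymbol u_{j,h}^{M}\|^2+\alpha_j\Delta t\sum_{n=1}^{M}\|\nabla\boldsymbol u_{j,h}^n\|^2+2\gamma\Delta t\sum_{n=1}^{M}\|\nabla\cdot\boldsymbol u_{j,h}^{n}\|^2\le\|\boldsymbol u_{j,h}^{0}\|^2+\bar\nu_{\min}\Delta t\|\nabla\boldsymbol u_{j,h}^{0}\|^2+\frac{2\Delta t}{\alpha_j}\sum_{n=1}^{M}\|\boldsymbol f_j(t_n)\|_{-1}^2 .$$ -/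

import Mathlib

open MeasureTheory

noncomputable section

namespace EEV

/-- Points of space and values of velocity fields: `ℝᵈ` with the Euclidean norm. -/
abbrev Vec (d : ℕ) : Type := EuclideanSpace ℝ (Fin d)

/-- `d × d` matrices with the Frobenius inner product `A : B`. -/
abbrev Mat (d : ℕ) : Type := EuclideanSpace ℝ (Fin d × Fin d)

/-- Lebesgue measure on the domain `D`. -/
abbrev vol {d : ℕ} (D : Set (Vec d)) : Measure (Vec d) := volume.restrict D

/-- `L²(D)`. -/
abbrev L2 {d : ℕ} (D : Set (Vec d)) : Type := Lp ℝ 2 (vol D)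

/-- `L²(D)ᵈ`. -/
abbrev L2Vec {d : ℕ} (D : Set (Vec d)) : Type := Lp (Vec d) 2 (vol D)

/-- `L²(D)ᵈˣᵈ`. -/
abbrev L2Mat {d : ℕ} (D : Set (Vec d)) : Type := Lp (Mat d) 2 (vol D)

/-- The classical gradient matrix: the entry `(i, k)` is `∂ₖ φᵢ`. -/
def gradMat {d : ℕ} (φ : Vec d → Vec d) (x : Vec d) : Mat d :=
  WithLp.toLp 2 fun ik => (fderiv ℝ φ x (EuclideanSpace.single ik.2 1)) ik.1

/-- `φ` is a smooth vector field with compact support contained in `D`. -/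
def IsTestField {d : ℕ} (D : Set (Vec d)) (φ : Vec d → Vec d) : Prop :=
  ContDiff ℝ (⊤ : ℕ∞) φ ∧ HasCompactSupport φ ∧ tsupport φ ⊆ D

/-- The pairs `(φ, ∇φ)` of (classes of) a test field and its gradient. -/
def testPairs {d : ℕ} (D : Set (Vec d)) : Set (L2Vec D × L2Mat D) :=
  {z | ∃ φ : Vec d → Vec d, IsTestField D φ ∧
    (z.1 : Vec d → Vec d) =ᵐ[vol D] φ ∧ (z.2 : Vec d → Mat d) =ᵐ[vol D] gradMat φ}

/-- The velocity space `X = H₀¹(D)ᵈ`: the closure of the test fields in the `H¹` norm, realised as a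
closed subspace of `L² × L²` by identifying `v` with the pair `(v, ∇v)` of the field and its weak
gradient. -/
def H10 {d : ℕ} (D : Set (Vec d)) : Submodule ℝ (L2Vec D × L2Mat D) :=
  (Submodule.span ℝ (testPairs D)).topologicalClosure

/-- The field underlying an element of `X`. -/
def val {d : ℕ} {D : Set (Vec d)} (v : H10 D) : L2Vec D := v.1.1

/-- The weak gradient of an element of `X`; the entry `(i, k)` is `∂ₖ vᵢ`. -/
def grad {d : ℕ} {D : Set (Vec d)} (v : H10 D) : L2Mat D := v.1.2

/-- The trace of a matrix as a continuous linear map. -/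
def traceL (d : ℕ) : Mat d →L[ℝ] ℝ := ∑ i : Fin d, EuclideanSpace.proj (i, i)

/-- The divergence of an element of `X`, the trace of its gradient. -/
def divg {d : ℕ} {D : Set (Vec d)} (v : H10 D) : L2 D := (traceL d).compLp (grad v)

/-- The pressure space `Q = L₀²(D)` of square integrable functions of mean zero. -/
def L20 {d : ℕ} (D : Set (Vec d)) : Set (L2 D) := {q | ∫ x in D, q x = 0}

/-- The space `V` of divergence free elements of `X`. -/
def divFree {d : ℕ} (D : Set (Vec d)) : Set (H10 D) :=
  {v | ∀ q ∈ L20 D, inner ℝ (divg v) q = 0}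

/-- `H⁻¹(D)`, the topological dual of `X`. -/
abbrev Hneg1 {d : ℕ} (D : Set (Vec d)) : Type := H10 D →L[ℝ] ℝ

/-- The norm `‖g‖₋₁ = sup |⟨g, v⟩| / ‖∇v‖` of `H⁻¹(D)` (the term with `v = 0` is `0 / 0 = 0`). -/
def negNorm {d : ℕ} {D : Set (Vec d)} (g : Hneg1 D) : ℝ := ⨆ v : H10 D, |g v| / ‖grad v‖

/-- The integral `(u · ∇v, w)`, where `(u · ∇v)ᵢ = ∑ₖ uₖ ∂ₖ vᵢ`. -/
def convec {d : ℕ} {D : Set (Vec d)} (u v w : H10 D) : ℝ :=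
  ∫ x in D, ∑ i : Fin d, (∑ k : Fin d, val u x k * grad v x (i, k)) * val w x i

/-- The skew symmetric trilinear form `b*(u, v, w)`. -/
def bStar {d : ℕ} {D : Set (Vec d)} (u v w : H10 D) : ℝ :=
  1 / 2 * convec u v w - 1 / 2 * convec u w v

/-- The weighted form `(a ∇u, ∇v)` with a scalar coefficient `a`. -/
def gradForm {d : ℕ} {D : Set (Vec d)} (a : Vec d → ℝ) (u v : H10 D) : ℝ :=
  ∫ x in D, a x * inner ℝ (grad u x) (grad v x)

/-- The mean viscosity `ν̄`. -/
def nuBar {d J : ℕ} (ν : Fin J → Vec d → ℝ) (x : Vec d) : ℝ := 1 / (J : ℝ) * ∑ j, ν j x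

/-- The viscosity fluctuation `ν'ⱼ = νⱼ - ν̄`. -/
def nuFluct {d J : ℕ} (ν : Fin J → Vec d → ℝ) (j : Fin J) (x : Vec d) : ℝ := ν j x - nuBar ν x

/-- The (essential) minimum `ν̄_min` of the mean viscosity over `D`. -/
def nuBarMin {d J : ℕ} (D : Set (Vec d)) (ν : Fin J → Vec d → ℝ) : ℝ := essInf (nuBar ν) (vol D)

/-- `αⱼ = ν̄_min - ‖ν'ⱼ‖_∞`. -/
def alpha {d J : ℕ} (D : Set (Vec d)) (ν : Fin J → Vec d → ℝ) (j : Fin J) : ℝ :=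
  nuBarMin D ν - (eLpNorm (nuFluct ν j) ⊤ (vol D)).toReal

/-- The ensemble mean `<u>` of the velocities of one time level. -/
def mean {d J : ℕ} {D : Set (Vec d)} (u : Fin J → H10 D) : H10 D := (1 / (J : ℝ)) • ∑ j, u j

/-- The velocity fluctuation `u'ⱼ = uⱼ - <u>`. -/
def fluct {d J : ℕ} {D : Set (Vec d)} (u : Fin J → H10 D) (j : Fin J) : H10 D := u j - mean u

/-- The mixing length `l = (∑ⱼ |u'ⱼ|²)^(1/2)`. -/
def mixLen {d J : ℕ} {D : Set (Vec d)} (u : Fin J → H10 D) (x : Vec d) : ℝ :=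
  Real.sqrt (∑ j, ‖val (fluct u j) x‖ ^ 2)

/-- The discrete ensemble eddy viscosity `ν_T = μ Δt l²`. -/
def nuT {d J : ℕ} {D : Set (Vec d)} (μ Δt : ℝ) (u : Fin J → H10 D) (x : Vec d) : ℝ :=
  μ * Δt * mixLen u x ^ 2

/-- `X_h` is a finite dimensional subspace of `X` whose elements are bounded and have bounded
gradients, as those of every conforming finite element space do. -/
def IsVelocitySpace {d : ℕ} {D : Set (Vec d)} (Xh : Submodule ℝ (H10 D)) : Prop :=
  FiniteDimensional ℝ Xh ∧
    ∀ v ∈ Xh, MemLp (val v) ⊤ (vol D) ∧ MemLp (grad v) ⊤ (vol D)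

/-- `Q_h` is a finite dimensional subspace of `Q`. -/
def IsPressureSpace {d : ℕ} {D : Set (Vec d)} (Qh : Submodule ℝ (L2 D)) : Prop :=
  FiniteDimensional ℝ Qh ∧ (Qh : Set (L2 D)) ⊆ L20 D

/-- `u j n` and `p j n`, `n ≤ M`, are produced by `M` steps of the linearized backward Euler ensemble
eddy viscosity scheme with step `Δt` in `X_h × Q_h`. Here `u j 0` is the initial velocity; `p j 0`
plays no role. -/
structure IsBESolution {d J : ℕ} {D : Set (Vec d)} (Xh : Submodule ℝ (H10 D))
    (Qh : Submodule ℝ (L2 D)) (ν : Fin J → Vec d → ℝ) (f : Fin J → ℝ → Hneg1 D)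
    (γ μ Δt : ℝ) (M : ℕ) (u : Fin J → ℕ → H10 D) (p : Fin J → ℕ → L2 D) : Prop where
  velocity_mem : ∀ j, ∀ n < M, u j (n + 1) ∈ Xh
  pressure_mem : ∀ j, ∀ n < M, p j (n + 1) ∈ Qh
  momentum : ∀ j, ∀ n < M, ∀ χ ∈ Xh,
    1 / Δt * inner ℝ (val (u j (n + 1))) (val χ)
      + bStar (mean fun i => u i n) (u j (n + 1)) χ
      + gradForm (nuBar ν) (u j (n + 1)) χ
      + inner ℝ (γ • divg (u j (n + 1)) - p j (n + 1)) (divg χ)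
      + gradForm (fun x => 2 * nuT μ Δt (fun i => u i n) x) (u j (n + 1)) χ
    = (f j ((n + 1 : ℕ) * Δt) χ + 1 / Δt * inner ℝ (val (u j n)) (val χ))
      - bStar (fluct (fun i => u i n) j) (u j n) χ
      - gradForm (nuFluct ν j) (u j n) χ
  incompressible : ∀ j, ∀ n < M, ∀ q ∈ Qh, inner ℝ (divg (u j (n + 1))) q = 0

end EEV

end

/-!
The proof is the energy method: the momentum equation is tested with the new velocity
`w = uⱼⁿ⁺¹`, and every explicit term, with `v = uⱼⁿ`, is absorbed by a dissipative one. The identity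
`2 (w - v, w) = ‖w‖² - ‖v‖² + ‖w - v‖²` supplies the numerical dissipation `‖w - v‖²`, and the
pressure drops out by discrete incompressibility.

The delicate term is `b*(a, v, w)` with `a` the fluctuation of `uⱼⁿ`. As `b*(a, w, w) = 0`, it is
`-b*(a, w, v - w)`, and the divergence theorem turns this into
`-∫ (a · ∇w) · (v - w) - ½ ∫ (∇ · a) w · (v - w)` (`bStar_eq`). By Young's inequality the first
integral is bounded by `‖w - v‖²` and `∫ |a|² |∇w|²`; the latter is at most the eddy viscosity term,
since `2 μ ≥ 1` (`le_gradForm_nuT`). The second integral leaves `Δt ‖∇ · a‖²_∞ ‖w‖²`, which by the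
condition on the time step and Poincaré's inequality is a fraction of `αⱼ ‖∇w‖²`
(`neg_bStar_le`, `exists_norm_val_le`). For `n = 0` the condition says nothing, but then `a` is
divergence free, because the mean value of the divergence of an `H₀¹` field is zero
(`divg_mem_L20`). The viscosity fluctuation costs `‖ν'ⱼ‖_∞ = ν̄_min - αⱼ`, split equally between
the two time levels, so the resulting inequality `IsBESolution.energy_step` telescopes.

The divergence theorem for a product of three `H₀¹` fields, one of them bounded with bounded gradient
(`setIntegral_divPt_eq_zero`), is proved for test fields and extended by density in one field at a
time: with the other two fixed, the integral is a pairing with square integrable functions.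
-/

open MeasureTheory

noncomputable section

namespace EEV

variable {d J : ℕ} {D : Set (Vec d)}

/-! ### Test fields and density in `H₀¹` -/

theorem setIntegral_fderiv_eq_zero {g : Vec d → ℝ} (hg : ContDiff ℝ 1 g)
    (hc : HasCompactSupport g) (hD : tsupport g ⊆ D) (e : Vec d) :
    ∫ x in D, fderiv ℝ g x e = 0 := by
  have hz : ∀ x, x ∉ D → fderiv ℝ g x e = 0 := by
    intro x hx
    have : x ∉ tsupport (fderiv ℝ g) := fun h => hx (hD (tsupport_fderiv_subset ℝ h))
    rw [image_eq_zero_of_notMem_tsupport this]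
    rfl
  rw [setIntegral_eq_integral_of_forall_compl_eq_zero hz]
  have hcont : Continuous fun x => fderiv ℝ g x e :=
    (hg.continuous_fderiv one_ne_zero).clm_apply continuous_const
  have hcs : HasCompactSupport fun x => fderiv ℝ g x e := hc.fderiv_apply ℝ e
  have := integral_mul_fderiv_eq_neg_fderiv_mul_of_integrable (μ := (volume : Measure (Vec d)))
    (f := fun _ => (1 : ℝ)) (g := g) (v := e) (by simp)
    (by simpa using hcont.integrable_of_hasCompactSupport hcs)
    (by simpa using hg.continuous.integrable_of_hasCompactSupport hc)
    (by intro x _; fun_prop) (by intro x _; exact (hg.differentiable one_ne_zero) x)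
  simpa using this

namespace IsTestField

variable {φ ψ : Vec d → Vec d}

theorem contDiff_one (h : IsTestField D φ) : ContDiff ℝ 1 φ :=
  h.1.of_le (by exact_mod_cast le_top)

theorem differentiable (h : IsTestField D φ) : Differentiable ℝ φ :=
  h.contDiff_one.differentiable one_ne_zero

theorem continuous_gradMat (h : IsTestField D φ) : Continuous (gradMat φ) := by
  have := h.contDiff_one.continuous_fderiv one_ne_zero
  unfold gradMat
  fun_prop

theorem hasCompactSupport_gradMat (h : IsTestField D φ) : HasCompactSupport (gradMat φ) := by
  have := (HasCompactSupport.fderiv ℝ h.2.1).comp_left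
    (g := fun L : Vec d →L[ℝ] Vec d =>
      (WithLp.toLp 2 fun ik : Fin d × Fin d => (L (EuclideanSpace.single ik.2 1)) ik.1 : Mat d))
    (by ext; simp)
  exact this

theorem memLp (h : IsTestField D φ) (p : ENNReal) : MemLp φ p (vol D) :=
  h.contDiff_one.continuous.memLp_of_hasCompactSupport h.2.1


theorem memLp_gradMat (h : IsTestField D φ) (p : ENNReal) : MemLp (gradMat φ) p (vol D) :=
  h.continuous_gradMat.memLp_of_hasCompactSupport h.hasCompactSupport_gradMat

theorem add (h : IsTestField D φ) (h' : IsTestField D ψ) : IsTestField D (φ + ψ) :=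
  ⟨h.1.add h'.1, h.2.1.add h'.2.1,
    (tsupport_add φ ψ).trans (Set.union_subset h.2.2 h'.2.2)⟩

theorem const_smul (h : IsTestField D φ) (c : ℝ) : IsTestField D (c • φ) :=
  ⟨contDiff_const.smul h.1, h.2.1.smul_left (f := fun _ => c),
    (tsupport_smul_subset_right (fun _ => c) φ).trans h.2.2⟩

theorem zero : IsTestField D (0 : Vec d → Vec d) :=
  ⟨contDiff_const, HasCompactSupport.zero, by simp [tsupport]⟩

end IsTestField

/-- Test fields form a vector space, so `H₀¹` is the closure of `testPairs` itself. -/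
theorem span_testPairs :
    (Submodule.span ℝ (testPairs D) : Set (L2Vec D × L2Mat D)) = testPairs D := by
  refine Set.Subset.antisymm (fun z hz => ?_) Submodule.subset_span
  induction hz using Submodule.span_induction with
  | mem z hz => exact hz
  | zero =>
    refine ⟨0, .zero, Lp.coeFn_zero _ _ _, ?_⟩
    filter_upwards [Lp.coeFn_zero (Mat d) 2 (vol D)] with x hx
    simp only [Prod.snd_zero, hx]
    ext; simp [gradMat]
  | add y z _ _ hy hz =>
    obtain ⟨φ, hφ, h1, h2⟩ := hy
    obtain ⟨ψ, hψ, h3, h4⟩ := hz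
    refine ⟨φ + ψ, hφ.add hψ, (Lp.coeFn_add _ _).trans (h1.add h3), (Lp.coeFn_add _ _).trans ?_⟩
    filter_upwards [h2, h4] with x hx hy
    rw [Pi.add_apply, hx, hy]
    ext ik
    simp [gradMat, fderiv_add (hφ.differentiable x) (hψ.differentiable x)]
  | smul c y _ hy =>
    obtain ⟨φ, hφ, h1, h2⟩ := hy
    refine ⟨c • φ, hφ.const_smul c, (Lp.coeFn_smul _ _).trans (h1.const_smul c),
      (Lp.coeFn_smul _ _).trans ?_⟩
    filter_upwards [h2] with x hx
    rw [Pi.smul_apply, hx]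
    ext ik
    simp [gradMat, fderiv_const_smul (hφ.differentiable x)]

/-- The density of the test fields in `H₀¹`, as a principle for extending closed conditions. -/
theorem mem_of_isClosed {S : Set (L2Vec D × L2Mat D)} (hS : IsClosed S) (h : testPairs D ⊆ S)
    (v : H10 D) : v.1 ∈ S := by
  have hv : v.1 ∈ closure (Submodule.span ℝ (testPairs D) : Set (L2Vec D × L2Mat D)) := v.2
  rw [span_testPairs] at hv
  exact closure_minimal h hS hv

/-- A continuous linear functional on `L² × L²`, represented by a pair of square integrable
functions, vanishes on `H₀¹` as soon as it vanishes on the test fields. -/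
theorem integral_inner_eq_zero_of_testField {g : Vec d → Vec d} {G : Vec d → Mat d}
    (hg : MemLp g 2 (vol D)) (hG : MemLp G 2 (vol D))
    (h : ∀ φ, IsTestField D φ →
      ∫ x in D, (inner ℝ (g x) (φ x) + inner ℝ (G x) (gradMat φ x)) = 0) (v : H10 D) :
    ∫ x in D, (inner ℝ (g x) (val v x) + inner ℝ (G x) (grad v x)) = 0 := by
  have key : ∀ z : L2Vec D × L2Mat D, inner ℝ (hg.toLp g) z.1 + inner ℝ (hG.toLp G) z.2 =
      ∫ x in D, (inner ℝ (g x) (z.1 x) + inner ℝ (G x) (z.2 x)) := by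
    intro z
    rw [L2.inner_def, L2.inner_def, ← integral_add (L2.integrable_inner _ _)
      (L2.integrable_inner _ _)]
    refine integral_congr_ae ?_
    filter_upwards [hg.coeFn_toLp, hG.coeFn_toLp] with x h1 h2
    rw [h1, h2]
  have := mem_of_isClosed
    (S := {z | inner ℝ (hg.toLp g) z.1 + inner ℝ (hG.toLp G) z.2 = 0})
    (isClosed_eq (by fun_prop) continuous_const) ?_ v
  · exact (key v.1).symm.trans this
  · rintro z ⟨φ, hφ, h1, h2⟩
    refine (key z).trans ((integral_congr_ae ?_).trans (h φ hφ))
    filter_upwards [h1, h2] with x hx hy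
    rw [hx, hy]

/-! ### The divergence theorem for products -/

/-- The pointwise convection term `(a · ∇w) · v`, with the matrix `W` in the place of `∇w`. -/
def convPt (a : Vec d) (W : Mat d) (v : Vec d) : ℝ :=
  ∑ i : Fin d, (∑ k : Fin d, a k * W (i, k)) * v i

/-- The divergence of `(w · v) a`, expanded by the product rule: the matrices `A`, `W`, `V` stand
for the gradients of `a`, `w`, `v`. -/
def divPt (a : Vec d) (A : Mat d) (w : Vec d) (W : Mat d) (v : Vec d) (V : Mat d) : ℝ :=
  convPt a W v + convPt a V w + traceL d A * inner ℝ w v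

theorem traceL_apply (A : Mat d) : traceL d A = ∑ i, A (i, i) := by
  simp [traceL]

theorem divPt_swap (a : Vec d) (A : Mat d) (w : Vec d) (W : Mat d) (v : Vec d) (V : Mat d) :
    divPt a A w W v V = divPt a A v V w W := by
  rw [divPt, divPt, real_inner_comm]; ring

/-- The coefficient of `a` in `divPt a A w W v V`. -/
def divCoeffVal (w : Vec d) (W : Mat d) (v : Vec d) (V : Mat d) : Vec d :=
  WithLp.toLp 2 fun k => ∑ i, (W (i, k) * v i + w i * V (i, k))

/-- The coefficient of `A` in `divPt a A w W v V`. -/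
def divCoeffGrad (w v : Vec d) : Mat d :=
  WithLp.toLp 2 fun ik => if ik.1 = ik.2 then ∑ i, w i * v i else 0

/-- The coefficient of `w` in `divPt a A w W v V`. -/
def prodCoeffVal (a : Vec d) (A : Mat d) (v : Vec d) (V : Mat d) : Vec d :=
  WithLp.toLp 2 fun i => ∑ k, (a k * V (i, k) + A (k, k) * v i)

/-- The coefficient of `W` in `divPt a A w W v V`. -/
def prodCoeffGrad (a v : Vec d) : Mat d :=
  WithLp.toLp 2 fun ik => a ik.2 * v ik.1

theorem inner_prodCoeffGrad (a : Vec d) (W : Mat d) (v : Vec d) :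
    inner ℝ (prodCoeffGrad a v) W = convPt a W v := by
  simp only [prodCoeffGrad, convPt, PiLp.inner_apply, Fintype.sum_prod_type, Finset.sum_mul,
    RCLike.inner_apply, conj_trivial]
  exact Finset.sum_congr rfl fun i _ => Finset.sum_congr rfl fun k _ => by ring

theorem inner_divCoeff (a : Vec d) (A : Mat d) (w : Vec d) (W : Mat d) (v : Vec d) (V : Mat d) :
    inner ℝ (divCoeffVal w W v V) a + inner ℝ (divCoeffGrad w v) A = divPt a A w W v V := by
  have h1 : inner ℝ (divCoeffVal w W v V) a = convPt a W v + convPt a V w := by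
    simp only [divCoeffVal, convPt, PiLp.inner_apply, Finset.sum_mul, Finset.mul_sum,
      RCLike.inner_apply, conj_trivial]
    rw [Finset.sum_comm, ← Finset.sum_add_distrib]
    refine Finset.sum_congr rfl fun i _ => ?_
    rw [← Finset.sum_add_distrib]
    exact Finset.sum_congr rfl fun k _ => by ring
  have h2 : inner ℝ (divCoeffGrad w v) A = traceL d A * inner ℝ w v := by
    simp only [divCoeffGrad, traceL_apply, PiLp.inner_apply, Fintype.sum_prod_type, Finset.sum_mul,
      RCLike.inner_apply, conj_trivial]
    refine Finset.sum_congr rfl fun i _ => ?_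
    simp [mul_comm]
  rw [h1, h2, divPt]

theorem inner_prodCoeff (a : Vec d) (A : Mat d) (w : Vec d) (W : Mat d) (v : Vec d) (V : Mat d) :
    inner ℝ (prodCoeffVal a A v V) w + inner ℝ (prodCoeffGrad a v) W = divPt a A w W v V := by
  have h1 : inner ℝ (prodCoeffVal a A v V) w = convPt a V w + traceL d A * inner ℝ w v := by
    simp only [prodCoeffVal, convPt, PiLp.inner_apply, Finset.sum_mul, Finset.mul_sum, traceL_apply,
      RCLike.inner_apply, conj_trivial]
    rw [← Finset.sum_add_distrib]
    refine Finset.sum_congr rfl fun i _ => ?_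
    rw [← Finset.sum_add_distrib]
    exact Finset.sum_congr rfl fun k _ => by ring
  rw [h1, inner_prodCoeffGrad, divPt]; ring

section MemLp

open ENNReal

variable {p q r : ℝ≥0∞} [p.HolderTriple q r] {m : Measure (Vec d)}
  {a w v : Vec d → Vec d} {A W V : Vec d → Mat d}

theorem memLp_prodCoeffGrad (ha : MemLp a p m) (hv : MemLp v q m) :
    MemLp (fun x => prodCoeffGrad (a x) (v x)) r m :=
  .of_eval_piLp fun ik => (hv.eval_piLp ik.1).mul' (ha.eval_piLp ik.2)

theorem memLp_prodCoeffVal (ha : MemLp a p m) (hA : MemLp A p m) (hv : MemLp v q m)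
    (hV : MemLp V q m) : MemLp (fun x => prodCoeffVal (a x) (A x) (v x) (V x)) r m :=
  .of_eval_piLp fun i => memLp_finsetSum Finset.univ fun k _ =>
    ((hV.eval_piLp (i, k)).mul' (ha.eval_piLp k)).add ((hv.eval_piLp i).mul' (hA.eval_piLp (k, k)))

theorem memLp_divCoeffVal (hw : MemLp w p m) (hW : MemLp W p m) (hv : MemLp v q m)
    (hV : MemLp V q m) : MemLp (fun x => divCoeffVal (w x) (W x) (v x) (V x)) r m :=
  .of_eval_piLp fun k => memLp_finsetSum Finset.univ fun i _ =>
    ((hv.eval_piLp i).mul' (hW.eval_piLp (i, k))).add ((hV.eval_piLp (i, k)).mul' (hw.eval_piLp i))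

theorem memLp_divCoeffGrad (hw : MemLp w p m) (hv : MemLp v q m) :
    MemLp (fun x => divCoeffGrad (w x) (v x)) r m := by
  refine .of_eval_piLp fun ik => ?_
  by_cases h : ik.1 = ik.2
  · simpa only [divCoeffGrad, h, if_true] using
      memLp_finsetSum _ fun i _ => (hv.eval_piLp i).mul' (hw.eval_piLp i)
  · simp [divCoeffGrad, h]

end MemLp

theorem IsTestField.hasFDerivAt_coord {φ : Vec d → Vec d} (h : IsTestField D φ) (k : Fin d)
    (x : Vec d) :
    HasFDerivAt (fun x => φ x k) ((EuclideanSpace.proj k : Vec d →L[ℝ] ℝ).comp (fderiv ℝ φ x)) x :=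
  (EuclideanSpace.proj k : Vec d →L[ℝ] ℝ).hasFDerivAt.comp x (h.differentiable x).hasFDerivAt

/-- The divergence theorem for a vector field that vanishes wherever some test field does. -/
theorem IsTestField.setIntegral_sum_fderiv_eq_zero {φ : Vec d → Vec d} (hφ : IsTestField D φ)
    {g : Fin d → Vec d → ℝ} (hg : ∀ k, ContDiff ℝ 1 (g k)) (h0 : ∀ k x, φ x = 0 → g k x = 0) :
    ∫ x in D, ∑ k, fderiv ℝ (g k) x (EuclideanSpace.single k 1) = 0 := by
  have hs : ∀ k, Function.support (g k) ⊆ Function.support φ := fun k x hx h => hx (h0 k x h)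
  have hgc : ∀ k, HasCompactSupport (g k) := fun k => hφ.2.1.mono (hs k)
  have hgD : ∀ k, tsupport (g k) ⊆ D := fun k => (closure_mono (hs k)).trans hφ.2.2
  rw [integral_finsetSum]
  · exact Finset.sum_eq_zero fun k _ => setIntegral_fderiv_eq_zero (hg k) (hgc k) (hgD k) _
  · intro k _
    exact ((((hg k).continuous_fderiv one_ne_zero).clm_apply
      continuous_const).integrable_of_hasCompactSupport ((hgc k).fderiv_apply ℝ _)).restrict

/-- The divergence theorem for `(ψ · χ) φ`, the product of three test fields. -/
theorem setIntegral_divPt_testField {φ ψ χ : Vec d → Vec d} (hφ : IsTestField D φ)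
    (hψ : IsTestField D ψ) (hχ : IsTestField D χ) :
    ∫ x in D, divPt (φ x) (gradMat φ x) (ψ x) (gradMat ψ x) (χ x) (gradMat χ x) = 0 := by
  let g : Fin d → Vec d → ℝ := fun k x => φ x k * inner ℝ (ψ x) (χ x)
  have hg : ∀ k, ContDiff ℝ 1 (g k) := fun k => by
    have h1 := hφ.contDiff_one
    have h2 := hψ.contDiff_one
    have h3 := hχ.contDiff_one
    have h4 : ContDiff ℝ 1 fun x => φ x k := by fun_prop
    exact h4.mul (h2.inner ℝ h3)
  refine (integral_congr_ae (.of_forall fun x => ?_)).trans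
    (hφ.setIntegral_sum_fderiv_eq_zero hg fun k x hx => by simp [g, hx])
  have hk : ∀ k, fderiv ℝ (g k) x (EuclideanSpace.single k 1) =
      φ x k * (∑ i, (ψ x i * gradMat χ x (i, k) + gradMat ψ x (i, k) * χ x i))
        + gradMat φ x (k, k) * inner ℝ (ψ x) (χ x) := by
    intro k
    have h2 := (hψ.differentiable x).hasFDerivAt.inner ℝ (hχ.differentiable x).hasFDerivAt
    have h3 : HasFDerivAt (g k) _ x := (hφ.hasFDerivAt_coord k x).mul h2
    rw [h3.fderiv]
    simp [gradMat, fderivInnerCLM_apply, PiLp.inner_apply, Finset.sum_add_distrib, mul_comm]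
  simp only [hk, divPt, convPt, traceL_apply, mul_add, Finset.sum_add_distrib, Finset.sum_mul,
    Finset.mul_sum]
  rw [Finset.sum_comm, add_comm (∑ x_1, ∑ i, φ x x_1 * _)]
  congr 2
  · exact Finset.sum_congr rfl fun k _ => Finset.sum_congr rfl fun i _ => by ring
  · rw [Finset.sum_comm]
    exact Finset.sum_congr rfl fun k _ => Finset.sum_congr rfl fun i _ => by ring

theorem memLp_val (v : H10 D) : MemLp (val v) 2 (vol D) := Lp.memLp _
theorem memLp_grad (v : H10 D) : MemLp (grad v) 2 (vol D) := Lp.memLp _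

/-- The divergence theorem for `(w · v) a` in `H₀¹`, where one factor has to be bounded together
with its gradient to make sense of the integral. The three fields are approximated by test fields one
after the other; at each stage the integral is a continuous functional of the field that moves. -/
theorem setIntegral_divPt_eq_zero (a w v : H10 D) (hw : MemLp (val w) ⊤ (vol D))
    (hW : MemLp (grad w) ⊤ (vol D)) :
    ∫ x in D, divPt (val a x) (grad a x) (val w x) (grad w x) (val v x) (grad v x) = 0 := by
  have step1 : ∀ ψ χ, IsTestField D ψ → IsTestField D χ → ∀ a : H10 D,
      ∫ x in D, divPt (val a x) (grad a x) (ψ x) (gradMat ψ x) (χ x) (gradMat χ x) = 0 := by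
    intro ψ χ hψ hχ a
    simp only [← inner_divCoeff]
    refine integral_inner_eq_zero_of_testField
      (memLp_divCoeffVal (hψ.memLp 2) (hψ.memLp_gradMat 2) (hχ.memLp ⊤) (hχ.memLp_gradMat ⊤))
      (memLp_divCoeffGrad (hψ.memLp 2) (hχ.memLp ⊤)) (fun φ hφ => ?_) a
    simpa only [inner_divCoeff] using setIntegral_divPt_testField hφ hψ hχ
  have step2 : ∀ χ, IsTestField D χ → ∀ a w : H10 D,
      ∫ x in D, divPt (val a x) (grad a x) (val w x) (grad w x) (χ x) (gradMat χ x) = 0 := by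
    intro χ hχ a w
    simp only [← inner_prodCoeff]
    refine integral_inner_eq_zero_of_testField
      (memLp_prodCoeffVal (memLp_val a) (memLp_grad a) (hχ.memLp ⊤) (hχ.memLp_gradMat ⊤))
      (memLp_prodCoeffGrad (memLp_val a) (hχ.memLp ⊤)) (fun ψ hψ => ?_) w
    simpa only [inner_prodCoeff] using step1 ψ χ hψ hχ a
  simp only [divPt_swap _ _ (val w _)]
  simp only [← inner_prodCoeff]
  refine integral_inner_eq_zero_of_testField
    (memLp_prodCoeffVal (memLp_val a) (memLp_grad a) hw hW)
    (memLp_prodCoeffGrad (memLp_val a) hw) (fun χ hχ => ?_) v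
  simp only [inner_prodCoeff]
  simpa only [divPt_swap _ _ (val w _)] using step2 χ hχ a w

/-- The integral of the divergence of an `H₀¹` field over a bounded domain is zero. -/
theorem divg_mem_L20 (hDb : Bornology.IsBounded D) (v : H10 D) : divg v ∈ L20 D := by
  have : IsFiniteMeasure (vol D) := ⟨by simpa using hDb.measure_lt_top⟩
  let I : Mat d := WithLp.toLp 2 fun ik => if ik.1 = ik.2 then 1 else 0
  have hI : ∀ A : Mat d, inner ℝ I A = traceL d A := fun A => by
    simp [I, traceL_apply, PiLp.inner_apply, Fintype.sum_prod_type]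
  have := integral_inner_eq_zero_of_testField (D := D) (g := 0) (G := fun _ => I) MemLp.zero
    (memLp_const I) (fun φ hφ => ?_) v
  · refine (integral_congr_ae ?_).trans this
    filter_upwards [(traceL d).coeFn_compLp (grad v)] with x hx
    simp [divg, hx, hI]
  · have hg : ∀ k, ContDiff ℝ 1 (fun x => φ x k) := fun k => by
      have h1 := hφ.contDiff_one
      fun_prop
    refine (integral_congr_ae (.of_forall fun x => ?_)).trans
      (hφ.setIntegral_sum_fderiv_eq_zero hg fun k x hx => by simp [hx])
    simp only [Pi.zero_apply, inner_zero_left, zero_add, hI, traceL_apply]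
    refine Finset.sum_congr rfl fun k _ => ?_
    rw [(hφ.hasFDerivAt_coord k x).fderiv]
    simp [gradMat]

theorem divg_eq_zero_of_mem_divFree (hDb : Bornology.IsBounded D) {v : H10 D}
    (hv : v ∈ divFree D) : divg v = 0 :=
  inner_self_eq_zero.mp (hv _ (divg_mem_L20 hDb v))

/-! ### Poincaré's inequality and the dual norm -/

theorem norm_sq_eq_integral {E : Type*} [NormedAddCommGroup E] [InnerProductSpace ℝ E]
    {α : Type*} [MeasurableSpace α] {m : Measure α} (f : Lp E 2 m) :
    ‖f‖ ^ 2 = ∫ x, ‖f x‖ ^ 2 ∂m := by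
  rw [← real_inner_self_eq_norm_sq, L2.inner_def]
  simp only [real_inner_self_eq_norm_sq]

theorem integrable_norm_sq {E : Type*} [NormedAddCommGroup E]
    {α : Type*} [MeasurableSpace α] {m : Measure α} (f : Lp E 2 m) :
    Integrable (fun x => ‖f x‖ ^ 2) m :=
  (Lp.memLp f).integrable_norm_pow two_ne_zero

theorem norm_fderiv_single_le_norm_gradMat (φ : Vec d → Vec d) (x : Vec d) (k : Fin d) :
    ‖fderiv ℝ φ x (EuclideanSpace.single k 1)‖ ≤ ‖gradMat φ x‖ := by
  rw [EuclideanSpace.norm_eq, EuclideanSpace.norm_eq]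
  refine Real.sqrt_le_sqrt ?_
  rw [Fintype.sum_prod_type]
  exact Finset.sum_le_sum fun i _ => Finset.single_le_sum
    (f := fun k => ‖gradMat φ x (i, k)‖ ^ 2) (fun _ _ => sq_nonneg _) (Finset.mem_univ k)

/-- Poincaré's inequality for test fields, from the divergence theorem for the scalar function
`xₖ |φ|²` differentiated in the direction `k`. -/
theorem IsTestField.integral_norm_sq_le {φ : Vec d → Vec d} (hφ : IsTestField D φ)
    (hDm : MeasurableSet D) {R : ℝ} (hR : ∀ x ∈ D, ‖x‖ ≤ R) (k : Fin d) :
    ∫ x in D, ‖φ x‖ ^ 2 ≤ (2 * R) ^ 2 * ∫ x in D, ‖gradMat φ x‖ ^ 2 := by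
  set e : Vec d := EuclideanSpace.single k 1
  have h1 := hφ.contDiff_one
  let g : Vec d → ℝ := fun x => x k * inner ℝ (φ x) (φ x)
  have hg : ContDiff ℝ 1 g := by
    have h4 : ContDiff ℝ 1 fun x : Vec d => x k := by fun_prop
    exact h4.mul (h1.inner ℝ h1)
  have hs : Function.support g ⊆ Function.support φ := fun x hx h => hx (by simp [g, h])
  have hz := setIntegral_fderiv_eq_zero hg (hφ.2.1.mono hs) ((closure_mono hs).trans hφ.2.2) e
  have hpt : ∀ x, fderiv ℝ g x e = ‖φ x‖ ^ 2 + x k * (2 * inner ℝ (φ x) (fderiv ℝ φ x e)) := by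
    intro x
    have h2 := (hφ.differentiable x).hasFDerivAt.inner ℝ (hφ.differentiable x).hasFDerivAt
    have h3 : HasFDerivAt g _ x :=
      (EuclideanSpace.proj k : Vec d →L[ℝ] ℝ).hasFDerivAt.mul h2
    rw [h3.fderiv]
    simp [e, fderivInnerCLM_apply, real_inner_comm, two_mul]
    ring
  have hi1 : Integrable (fun x => ‖φ x‖ ^ 2) (vol D) :=
    (hφ.memLp 2).integrable_norm_pow two_ne_zero
  have hi2 : Integrable (fun x => ‖gradMat φ x‖ ^ 2) (vol D) :=
    (hφ.memLp_gradMat 2).integrable_norm_pow two_ne_zero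
  have hi3 : Integrable (fun x => fderiv ℝ g x e) (vol D) :=
    (((hg.continuous_fderiv one_ne_zero).clm_apply
      continuous_const).integrable_of_hasCompactSupport
        ((hφ.2.1.mono hs).fderiv_apply ℝ _)).restrict
  have hle : ∫ x in D, (1 / 2 * ‖φ x‖ ^ 2 - 2 * R ^ 2 * ‖gradMat φ x‖ ^ 2) ≤
      ∫ x in D, fderiv ℝ g x e := by
    refine setIntegral_mono_on ((hi1.const_mul _).sub (hi2.const_mul _)) hi3 hDm fun x hx => ?_
    rw [hpt]
    have h5 : |x k * inner ℝ (φ x) (fderiv ℝ φ x e)| ≤ R * (‖φ x‖ * ‖gradMat φ x‖) := by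
      rw [abs_mul]
      have := (PiLp.norm_apply_le x k).trans (hR x hx)
      refine mul_le_mul this ((abs_real_inner_le_norm _ _).trans ?_) (abs_nonneg _)
        ((norm_nonneg _).trans this)
      exact mul_le_mul_of_nonneg_left (norm_fderiv_single_le_norm_gradMat φ x k) (norm_nonneg _)
    nlinarith [(abs_le.mp h5).1, sq_nonneg (‖φ x‖ - 2 * R * ‖gradMat φ x‖)]
  rw [hz, integral_sub (hi1.const_mul _) (hi2.const_mul _), integral_const_mul,
    integral_const_mul] at hle
  linarith

/-- Poincaré's inequality on a bounded domain. -/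
theorem exists_norm_val_le (hd : 0 < d) (hDm : MeasurableSet D) (hDb : Bornology.IsBounded D) :
    ∃ K : ℝ, 0 < K ∧ ∀ v : H10 D, ‖val v‖ ≤ K * ‖grad v‖ := by
  obtain ⟨R, hR0, hR⟩ := hDb.exists_pos_norm_le
  refine ⟨2 * R, by positivity, fun v => ?_⟩
  refine mem_of_isClosed (S := {z | ‖z.1‖ ≤ 2 * R * ‖z.2‖})
    (isClosed_le (by fun_prop) (by fun_prop)) ?_ v
  rintro z ⟨φ, hφ, h1, h2⟩
  have h3 : ‖z.1‖ ^ 2 = ∫ x in D, ‖φ x‖ ^ 2 := by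
    rw [norm_sq_eq_integral]
    exact integral_congr_ae (h1.mono fun x hx => by simp only [hx])
  have h4 : ‖z.2‖ ^ 2 = ∫ x in D, ‖gradMat φ x‖ ^ 2 := by
    rw [norm_sq_eq_integral]
    exact integral_congr_ae (h2.mono fun x hx => by simp only [hx])
  have h5 := hφ.integral_norm_sq_le hDm hR ⟨0, hd⟩
  rw [← h3, ← h4, ← mul_pow] at h5
  exact le_of_sq_le_sq h5 (by positivity)

/-- Poincaré's inequality makes the supremum in `negNorm` finite, and `g v = 0` where `∇v = 0`. -/
theorem abs_apply_le_negNorm {K : ℝ} (hK : ∀ v : H10 D, ‖val v‖ ≤ K * ‖grad v‖) (g : Hneg1 D)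
    (v : H10 D) : |g v| ≤ negNorm g * ‖grad v‖ := by
  have hb : ∀ w : H10 D, |g w| ≤ ‖g‖ * max K 1 * ‖grad w‖ := by
    intro w
    refine (g.le_opNorm w).trans ?_
    rw [mul_assoc]
    refine mul_le_mul_of_nonneg_left ?_ (norm_nonneg _)
    refine max_le ((hK w).trans ?_) ?_
    · exact mul_le_mul_of_nonneg_right (le_max_left _ _) (norm_nonneg _)
    · exact le_mul_of_one_le_left (norm_nonneg _) (le_max_right _ _)
  rcases (norm_nonneg (grad v)).eq_or_lt with h0 | h0
  · have := hb v
    rw [← h0, mul_zero] at this ⊢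
    exact this
  · rw [← div_le_iff₀ h0]
    refine le_ciSup (f := fun w : H10 D => |g w| / ‖grad w‖) ⟨‖g‖ * max K 1, ?_⟩ v
    rintro _ ⟨w, rfl⟩
    exact div_le_of_le_mul₀ (norm_nonneg _) (by positivity) (hb w)

/-! ### Estimates of the forms -/

section Integrability

open ENNReal

variable {p q r s : ℝ≥0∞} [p.HolderTriple q r] {m : Measure (Vec d)}
  {a w v : Vec d → Vec d} {W : Vec d → Mat d}

theorem memLp_inner (hw : MemLp w p m) (hv : MemLp v q m) :
    MemLp (fun x => inner ℝ (w x) (v x)) r m := by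
  simp only [PiLp.inner_apply, RCLike.inner_apply, conj_trivial, mul_comm]
  exact memLp_finsetSum Finset.univ fun i _ => (hv.eval_piLp i).mul' (hw.eval_piLp i)

theorem integrable_convPt [r.HolderTriple s 1] (ha : MemLp a p m) (hW : MemLp W q m)
    (hv : MemLp v s m) : Integrable (fun x => convPt (a x) (W x) (v x)) m := by
  rw [← memLp_one_iff_integrable]
  have h : ∀ i, MemLp (fun x => ∑ k, a x k * W x (i, k)) r m := fun i =>
    memLp_finsetSum Finset.univ fun k _ => (hW.eval_piLp (i, k)).mul' (ha.eval_piLp k)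
  exact memLp_finsetSum Finset.univ fun i _ => (hv.eval_piLp i).mul' (h i)

end Integrability

theorem ae_norm_le_toReal {E : Type*} [NormedAddCommGroup E] {α : Type*} [MeasurableSpace α]
    {m : Measure α} {g : α → E} (h : eLpNorm g ⊤ m ≠ ⊤) :
    ∀ᵐ x ∂m, ‖g x‖ ≤ (eLpNorm g ⊤ m).toReal := by
  rw [eLpNorm_exponent_top] at h ⊢
  filter_upwards [ae_le_eLpNormEssSup (f := g) (μ := m)] with x hx
  simpa using ENNReal.toReal_mono h hx

theorem abs_convPt_le (a : Vec d) (W : Mat d) (v : Vec d) :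
    |convPt a W v| ≤ ‖a‖ * ‖W‖ * ‖v‖ := by
  have h : ‖prodCoeffGrad a v‖ = ‖a‖ * ‖v‖ := by
    rw [EuclideanSpace.norm_eq, EuclideanSpace.norm_eq, EuclideanSpace.norm_eq, mul_comm,
      ← Real.sqrt_mul (by positivity), Fintype.sum_prod_type, Finset.sum_mul_sum]
    simp only [prodCoeffGrad, norm_mul, mul_pow, mul_comm]
  rw [← inner_prodCoeffGrad]
  refine (abs_real_inner_le_norm _ _).trans (le_of_eq ?_)
  rw [h]; ring

theorem val_sub (u w : H10 D) : val (u - w) = val u - val w := rfl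

theorem coeFn_divg (a : H10 D) : ∀ᵐ x ∂vol D, divg a x = traceL d (grad a x) :=
  (traceL d).coeFn_compLp (grad a)

/-- Since `b*(a, w, w) = 0`, only the increment `u - w` enters `b*(a, u, w) = -b*(a, w, u - w)`; the
divergence theorem removes its gradient. -/
theorem bStar_eq (a u w : H10 D) (hw : MemLp (val w) ⊤ (vol D)) (hW : MemLp (grad w) ⊤ (vol D)) :
    -bStar a u w = ∫ x in D, (convPt (val a x) (grad w x) (val (u - w) x)
      + 1 / 2 * (traceL d (grad a x) * inner ℝ (val w x) (val (u - w) x))) := by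
  have i1 : ∀ v : H10 D, Integrable (fun x => convPt (val a x) (grad w x) (val v x)) (vol D) :=
    fun v => integrable_convPt (r := 2) (memLp_val a) hW (memLp_val v)
  have i2 : ∀ v : H10 D, Integrable (fun x => convPt (val a x) (grad v x) (val w x)) (vol D) :=
    fun v => integrable_convPt (r := 1) (memLp_val a) (memLp_grad v) hw
  have i3 : ∀ v : H10 D, Integrable (fun x => traceL d (grad a x) * inner ℝ (val w x) (val v x))
      (vol D) := fun v =>
    ((traceL d).comp_memLp' (memLp_grad a)).integrable_mul
      (memLp_inner (r := 2) hw (memLp_val v))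
  have key : ∀ v : H10 D, convec a w v + convec a v w
      + ∫ x in D, traceL d (grad a x) * inner ℝ (val w x) (val v x) = 0 := by
    intro v
    have := setIntegral_divPt_eq_zero a w v hw hW
    simp only [divPt] at this
    have h := integral_add ((i1 v).add (i2 v)) (i3 v)
    simp only [Pi.add_apply] at h
    rwa [h, integral_add (i1 v) (i2 v)] at this
  have hae := Lp.coeFn_sub (val u) (val w)
  have e1 : ∫ x in D, convPt (val a x) (grad w x) (val (u - w) x) =
      convec a w u - convec a w w := by
    unfold convec
    refine Eq.trans ?_ (integral_sub (i1 u) (i1 w))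
    refine integral_congr_ae (hae.mono fun x hx => ?_)
    simp only [val_sub, hx, convPt, Pi.sub_apply, PiLp.sub_apply, mul_sub, Finset.sum_sub_distrib]
  have e2 : ∫ x in D, traceL d (grad a x) * inner ℝ (val w x) (val (u - w) x) =
      (∫ x in D, traceL d (grad a x) * inner ℝ (val w x) (val u x))
        - ∫ x in D, traceL d (grad a x) * inner ℝ (val w x) (val w x) := by
    rw [← integral_sub (i3 u) (i3 w)]
    refine integral_congr_ae (hae.mono fun x hx => ?_)
    simp only [val_sub, hx, Pi.sub_apply, inner_sub_right, mul_sub]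
  rw [integral_add (i1 _) ((i3 _).const_mul _), integral_const_mul, e1, e2, bStar]
  linarith [key u, key w]

theorem integrable_norm_sq_mul_norm_sq (a w : H10 D) (hW : MemLp (grad w) ⊤ (vol D)) :
    Integrable (fun x => ‖val a x‖ ^ 2 * ‖grad w x‖ ^ 2) (vol D) := by
  have : MemLp (fun x => ‖val a x‖ * ‖grad w x‖) 2 (vol D) := hW.norm.mul' (memLp_val a).norm
  simpa [mul_pow] using this.integrable_norm_pow two_ne_zero

/-- The explicit nonlinear term is controlled by the eddy viscosity of the fluctuation `a`, by the
numerical dissipation `‖u - w‖²`, and by the divergence of `a`. -/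
theorem neg_bStar_le (a u w : H10 D) (hw : MemLp (val w) ⊤ (vol D))
    (hW : MemLp (grad w) ⊤ (vol D)) {K : ℝ} (hK : ∀ᵐ x ∂vol D, ‖divg a x‖ ≤ K) (τ : ℝ) :
    2 * τ * -bStar a u w ≤ 2 * τ ^ 2 * (∫ x in D, ‖val a x‖ ^ 2 * ‖grad w x‖ ^ 2)
      + ‖val (u - w)‖ ^ 2 + 1 / 2 * τ ^ 2 * K ^ 2 * ‖val w‖ ^ 2 := by
  set v := u - w
  have i1 : Integrable (fun x => convPt (val a x) (grad w x) (val v x)) (vol D) :=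
    integrable_convPt (r := 2) (memLp_val a) hW (memLp_val v)
  have i2 : Integrable (fun x => traceL d (grad a x) * inner ℝ (val w x) (val v x)) (vol D) :=
    ((traceL d).comp_memLp' (memLp_grad a)).integrable_mul
      (memLp_inner (r := 2) hw (memLp_val v))
  have j1 := (integrable_norm_sq_mul_norm_sq a w hW).const_mul (2 * τ ^ 2)
  have j2 := integrable_norm_sq (val v)
  have j3 := (integrable_norm_sq (val w)).const_mul (1 / 2 * τ ^ 2 * K ^ 2)
  have hle : ∫ x in D, 2 * τ * (convPt (val a x) (grad w x) (val v x)
        + 1 / 2 * (traceL d (grad a x) * inner ℝ (val w x) (val v x))) ≤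
      ∫ x in D, (2 * τ ^ 2 * (‖val a x‖ ^ 2 * ‖grad w x‖ ^ 2) + ‖val v x‖ ^ 2
        + 1 / 2 * τ ^ 2 * K ^ 2 * ‖val w x‖ ^ 2) := by
    refine integral_mono_ae ((i1.add (i2.const_mul _)).const_mul _) ((j1.add j2).add j3) ?_
    filter_upwards [hK, coeFn_divg a] with x hx hdx
    rw [hdx, Real.norm_eq_abs] at hx
    have h1 : 2 * τ * convPt (val a x) (grad w x) (val v x) ≤
        2 * (|τ| * (‖val a x‖ * ‖grad w x‖ * ‖val v x‖)) := by
      have := mul_le_mul_of_nonneg_left (abs_convPt_le (val a x) (grad w x) (val v x))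
        (abs_nonneg τ)
      rw [← abs_mul] at this
      linarith [le_abs_self (τ * convPt (val a x) (grad w x) (val v x))]
    have h2 : τ * (traceL d (grad a x) * inner ℝ (val w x) (val v x)) ≤
        |τ| * (K * (‖val w x‖ * ‖val v x‖)) := by
      refine (le_abs_self _).trans ?_
      rw [abs_mul, abs_mul]
      exact mul_le_mul_of_nonneg_left (mul_le_mul hx (abs_real_inner_le_norm _ _) (abs_nonneg _)
        ((abs_nonneg _).trans hx)) (abs_nonneg _)
    have h3 : |τ| ^ 2 = τ ^ 2 := sq_abs τ
    rw [← h3]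
    nlinarith [sq_nonneg (2 * |τ| * (‖val a x‖ * ‖grad w x‖) - ‖val v x‖),
      sq_nonneg (|τ| * K * ‖val w x‖ - ‖val v x‖)]
  have h := integral_add (j1.add j2) j3
  simp only [Pi.add_apply] at h
  rwa [integral_const_mul, ← bStar_eq a u w hw hW, h, integral_add j1 j2, integral_const_mul,
    integral_const_mul, ← norm_sq_eq_integral, ← norm_sq_eq_integral] at hle

/-- The eddy viscosity dominates the contribution of each single fluctuation. -/
theorem le_gradForm_nuT {μ τ : ℝ} (hμ : 1 / 2 ≤ μ) (hτ : 0 ≤ τ) (u : Fin J → H10 D) (w : H10 D)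
    (hW : MemLp (grad w) ⊤ (vol D)) (j : Fin J) :
    τ * ∫ x in D, ‖val (fluct u j) x‖ ^ 2 * ‖grad w x‖ ^ 2 ≤
      gradForm (fun x => 2 * nuT μ τ u x) w w := by
  have hi := fun i => integrable_norm_sq_mul_norm_sq (fluct u i) w hW
  have hpt : ∀ x, 2 * nuT μ τ u x * inner ℝ (grad w x) (grad w x) =
      2 * μ * τ * ∑ i, ‖val (fluct u i) x‖ ^ 2 * ‖grad w x‖ ^ 2 := by
    intro x
    rw [nuT, mixLen, Real.sq_sqrt (Finset.sum_nonneg fun _ _ => sq_nonneg _),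
      real_inner_self_eq_norm_sq, ← Finset.sum_mul]
    ring
  simp only [gradForm, hpt]
  rw [← integral_const_mul]
  refine integral_mono ((hi j).const_mul _) ((integrable_finsetSum _ fun i _ => hi i).const_mul _)
    fun x => ?_
  have h1 := Finset.single_le_sum (f := fun i => ‖val (fluct u i) x‖ ^ 2 * ‖grad w x‖ ^ 2)
    (fun _ _ => by positivity) (Finset.mem_univ j)
  have h2 : 0 ≤ ∑ i, ‖val (fluct u i) x‖ ^ 2 * ‖grad w x‖ ^ 2 :=
    Finset.sum_nonneg fun _ _ => by positivity
  dsimp only at h1 ⊢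
  nlinarith [mul_le_mul_of_nonneg_left h1 hτ, mul_nonneg hτ h2]

theorem integrable_mul_inner_grad {a : Vec d → ℝ} (ha : MemLp a ⊤ (vol D)) (u w : H10 D) :
    Integrable (fun x => a x * inner ℝ (grad u x) (grad w x)) (vol D) :=
  (memLp_one_iff_integrable.mpr (L2.integrable_inner (𝕜 := ℝ) (grad u) (grad w))).integrable_mul ha
    |>.congr (.of_forall fun _ => mul_comm _ _)

theorem essInf_mul_le_gradForm {a : Vec d → ℝ} (ha : MemLp a ⊤ (vol D)) (w : H10 D) :
    essInf a (vol D) * ‖grad w‖ ^ 2 ≤ gradForm a w w := by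
  have hb : Filter.IsBoundedUnder (· ≥ ·) (ae (vol D)) a := by
    refine ⟨-(eLpNorm a ⊤ (vol D)).toReal, ?_⟩
    rw [Filter.eventually_map]
    filter_upwards [ae_norm_le_toReal ha.eLpNorm_ne_top] with x hx
    exact (abs_le.mp hx).1
  rw [norm_sq_eq_integral, ← integral_const_mul]
  refine integral_mono_ae ((integrable_norm_sq _).const_mul _) (integrable_mul_inner_grad ha w w) ?_
  filter_upwards [ae_essInf_le hb] with x hx
  rw [real_inner_self_eq_norm_sq]
  exact mul_le_mul_of_nonneg_right hx (sq_nonneg _)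

theorem neg_gradForm_le {a : Vec d → ℝ} (ha : MemLp a ⊤ (vol D)) (u w : H10 D) :
    2 * -gradForm a u w ≤
      (eLpNorm a ⊤ (vol D)).toReal * (‖grad u‖ ^ 2 + ‖grad w‖ ^ 2) := by
  have j1 := integrable_norm_sq (grad u)
  have j2 := integrable_norm_sq (grad w)
  rw [norm_sq_eq_integral, norm_sq_eq_integral, ← integral_add j1 j2, ← integral_const_mul,
    gradForm, ← integral_neg, ← integral_const_mul]
  refine integral_mono_ae ((integrable_mul_inner_grad ha u w).neg.const_mul _)
    ((j1.add j2).const_mul _) ?_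
  filter_upwards [ae_norm_le_toReal ha.eLpNorm_ne_top] with x hx
  have h1 : |a x * inner ℝ (grad u x) (grad w x)| ≤
      (eLpNorm a ⊤ (vol D)).toReal * (‖grad u x‖ * ‖grad w x‖) := by
    rw [abs_mul]
    exact mul_le_mul hx (abs_real_inner_le_norm _ _) (abs_nonneg _) ENNReal.toReal_nonneg
  have h2 := mul_le_mul_of_nonneg_left (two_mul_le_add_sq ‖grad u x‖ ‖grad w x‖)
    (ENNReal.toReal_nonneg (a := eLpNorm a ⊤ (vol D)))
  have h3 := neg_abs_le (a x * inner ℝ (grad u x) (grad w x))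
  linarith

/-- The condition on the time step in terms of real numbers; in particular the divergence is
essentially bounded. -/
theorem exists_ae_bound {Ω : Type*} [MeasurableSpace Ω] {m : Measure Ω} {g : Ω → ℝ} {τ c : ℝ}
    (hτ : 0 < τ) (hc : 0 ≤ c)
    (h : ENNReal.ofReal τ * eLpNorm g ⊤ m ^ 2 ≤ ENNReal.ofReal c) :
    ∃ K : ℝ, (∀ᵐ x ∂m, ‖g x‖ ≤ K) ∧ τ * K ^ 2 ≤ c := by
  have hfin : eLpNorm g ⊤ m ≠ ⊤ := by
    intro ht
    rw [ht, ENNReal.top_pow two_ne_zero, ENNReal.mul_top (by simpa using hτ)] at h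
    exact ENNReal.ofReal_ne_top (top_le_iff.mp h)
  refine ⟨_, ae_norm_le_toReal hfin, ?_⟩
  have := ENNReal.toReal_mono ENNReal.ofReal_ne_top h
  rwa [ENNReal.toReal_mul, ENNReal.toReal_pow, ENNReal.toReal_ofReal hτ.le,
    ENNReal.toReal_ofReal hc] at this

theorem divg_fluct_eq_zero {u : Fin J → H10 D} (h : ∀ j, divg (u j) = 0) (j : Fin J) :
    divg (fluct u j) = 0 := by
  let L : H10 D →L[ℝ] L2 D :=
    ((traceL d).compLpL 2 (vol D)).comp ((ContinuousLinearMap.snd ℝ _ _).comp (H10 D).subtypeL)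
  have hL : ∀ v, L v = divg v := fun _ => rfl
  rw [← hL, fluct, mean, map_sub, map_smul, map_sum]
  simp [hL, h]

theorem memLp_nuBar {ν : Fin J → Vec d → ℝ} (hν : ∀ j, MemLp (ν j) ⊤ (vol D)) :
    MemLp (nuBar ν) ⊤ (vol D) :=
  (memLp_finsetSum Finset.univ fun j _ => hν j).const_mul _

theorem memLp_nuFluct {ν : Fin J → Vec d → ℝ} (hν : ∀ j, MemLp (ν j) ⊤ (vol D)) (j : Fin J) :
    MemLp (nuFluct ν j) ⊤ (vol D) :=
  (hν j).sub (memLp_nuBar hν)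

/-! ### The energy inequality -/

/-- The energy inequality of a single time step: the momentum equation tested with the new velocity.
The numerical dissipation `‖uⁿ⁺¹ - uⁿ‖²` and the eddy viscosity are used up by the explicit nonlinear
term. The weight `ν̄_min - αⱼ = ‖ν'ⱼ‖_∞` of the gradient is the same at both time levels, so that the
inequality telescopes. -/
theorem IsBESolution.energy_step {Xh : Submodule ℝ (H10 D)} {Qh : Submodule ℝ (L2 D)}
    {ν : Fin J → Vec d → ℝ} {f : Fin J → ℝ → Hneg1 D} {γ μ τ : ℝ} {M : ℕ}
    {u : Fin J → ℕ → H10 D} {p : Fin J → ℕ → L2 D} (hs : IsBESolution Xh Qh ν f γ μ τ M u p)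
    (hX : IsVelocitySpace Xh) (hν : ∀ j, MemLp (ν j) ⊤ (vol D)) (hτ : 0 < τ) (hμ : 1 / 2 ≤ μ)
    {P : ℝ} (hP : 0 < P) (hPoinc : ∀ v : H10 D, ‖val v‖ ≤ P * ‖grad v‖)
    {j : Fin J} (hα : 0 < alpha D ν j) {n : ℕ} (hn : n < M) {K : ℝ}
    (hK : ∀ᵐ x ∂vol D, ‖divg (fluct (fun i => u i n) j) x‖ ≤ K)
    (hKτ : τ * K ^ 2 ≤ 1 / P ^ 2 * alpha D ν j) :
    ‖val (u j (n + 1))‖ ^ 2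
        + τ * (nuBarMin D ν - alpha D ν j) * ‖grad (u j (n + 1))‖ ^ 2
        + alpha D ν j * τ * ‖grad (u j (n + 1))‖ ^ 2
        + 2 * γ * τ * ‖divg (u j (n + 1))‖ ^ 2
      ≤ ‖val (u j n)‖ ^ 2 + τ * (nuBarMin D ν - alpha D ν j) * ‖grad (u j n)‖ ^ 2
        + 2 * τ / alpha D ν j * negNorm (f j ((n + 1 : ℕ) * τ)) ^ 2 := by
  have hmom := hs.momentum j n hn _ (hs.velocity_mem j n hn)
  have hp := hs.incompressible j n hn _ (hs.pressure_mem j n hn)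
  obtain ⟨hw, hW⟩ := hX.2 _ (hs.velocity_mem j n hn)
  set w := u j (n + 1)
  set v := u j n
  set a := fluct (fun i => u i n) j
  set α := alpha D ν j with hαdef
  set F := negNorm (f j ((n + 1 : ℕ) * τ))
  have hN : (eLpNorm (nuFluct ν j) ⊤ (vol D)).toReal = nuBarMin D ν - α := by
    rw [hαdef, alpha]; ring
  have hb0 : bStar (mean fun i => u i n) w w = 0 := by rw [bStar]; ring
  have hdiv : inner ℝ (γ • divg w - p j (n + 1)) (divg w) = γ * ‖divg w‖ ^ 2 := by
    rw [inner_sub_left, real_inner_smul_left, real_inner_self_eq_norm_sq, real_inner_comm, hp,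
      sub_zero]
  have hvw : ‖val (v - w)‖ ^ 2 = ‖val v‖ ^ 2 - 2 * inner ℝ (val v) (val w) + ‖val w‖ ^ 2 := by
    rw [val_sub, norm_sub_sq_real]
  have hbs := neg_bStar_le a v w hw hW hK τ
  have hνT := le_gradForm_nuT hμ hτ.le (fun i => u i n) w hW j
  have hνm : nuBarMin D ν * ‖grad w‖ ^ 2 ≤ gradForm (nuBar ν) w w :=
    essInf_mul_le_gradForm (memLp_nuBar hν) w
  have hνf := neg_gradForm_le (memLp_nuFluct hν j) v w
  rw [hN] at hνf
  have hf := (le_abs_self _).trans (abs_apply_le_negNorm hPoinc (f j ((n + 1 : ℕ) * τ)) w)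
  -- Young's inequality, splitting the load between the data and the dissipation
  have hyoung : 2 * τ * (F * ‖grad w‖) ≤ 2 * τ / α * F ^ 2 + 1 / 2 * (α * τ) * ‖grad w‖ ^ 2 := by
    have h : 2 * τ / α * F ^ 2 + 1 / 2 * (α * τ) * ‖grad w‖ ^ 2 - 2 * τ * (F * ‖grad w‖) =
        τ / (2 * α) * (2 * F - α * ‖grad w‖) ^ 2 := by
      field_simp
      ring
    have : 0 ≤ τ / (2 * α) * (2 * F - α * ‖grad w‖) ^ 2 := by positivity
    linarith
  have hKw : 1 / 2 * τ ^ 2 * K ^ 2 * ‖val w‖ ^ 2 ≤ 1 / 2 * (α * τ) * ‖grad w‖ ^ 2 := by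
    have h1 : ‖val w‖ ^ 2 ≤ P ^ 2 * ‖grad w‖ ^ 2 := by
      rw [← mul_pow]
      exact pow_le_pow_left₀ (norm_nonneg _) (hPoinc w) 2
    have h2 : τ * K ^ 2 * ‖val w‖ ^ 2 ≤ 1 / P ^ 2 * α * (P ^ 2 * ‖grad w‖ ^ 2) :=
      mul_le_mul hKτ h1 (sq_nonneg _) (by positivity)
    have h3 : 1 / P ^ 2 * α * (P ^ 2 * ‖grad w‖ ^ 2) = α * ‖grad w‖ ^ 2 := by field_simp
    rw [h3] at h2
    linarith [mul_le_mul_of_nonneg_left h2 hτ.le]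
  rw [hb0, hdiv, real_inner_self_eq_norm_sq] at hmom
  -- the momentum equation tested with `w`, multiplied by `2 * τ`
  have henergy : 2 * ‖val w‖ ^ 2 + 2 * τ * gradForm (nuBar ν) w w + 2 * γ * τ * ‖divg w‖ ^ 2
      + 2 * τ * gradForm (fun x => 2 * nuT μ τ (fun i => u i n) x) w w
      = 2 * τ * f j ((n + 1 : ℕ) * τ) w + 2 * inner ℝ (val v) (val w)
        + 2 * τ * -bStar a v w + τ * (2 * -gradForm (nuFluct ν j) v w) := by
    have hc : τ * (1 / τ) = 1 := mul_one_div_cancel hτ.ne'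
    linear_combination 2 * τ * hmom + (2 * inner ℝ (val v) (val w) - 2 * ‖val w‖ ^ 2) * hc
  have e1 := mul_le_mul_of_nonneg_left hνT (by positivity : 0 ≤ 2 * τ)
  have e2 := mul_le_mul_of_nonneg_left hνm (by positivity : 0 ≤ 2 * τ)
  have e3 := mul_le_mul_of_nonneg_left hνf hτ.le
  have e4 := mul_le_mul_of_nonneg_left hf (by positivity : 0 ≤ 2 * τ)
  linarith

end EEV

end

theorem mainTheorem1 {d : ℕ} (hd : d = 2 ∨ d = 3) (D : Set (EEV.Vec d)) (hDo : IsOpen D)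
    (hDb : Bornology.IsBounded D) :
    ∃ C : ℝ, 0 < C ∧
      ∀ (J : ℕ) (ν : Fin J → EEV.Vec d → ℝ) (T Δt γ μ : ℝ) (M : ℕ)
        (f : Fin J → ℝ → EEV.Hneg1 D)
        (Xh : Submodule ℝ (EEV.H10 D)) (Qh : Submodule ℝ (EEV.L2 D))
        (u : Fin J → ℕ → EEV.H10 D) (p : Fin J → ℕ → EEV.L2 D),
        0 < T → 0 < Δt → M * Δt = T → 0 < γ → 1 / 2 ≤ μ →
        (∀ j, MemLp (ν j) ⊤ (EEV.vol D)) →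
        (∀ j, 0 < EEV.alpha D ν j) →
        (∀ j, MemLp (f j) ⊤ (volume.restrict (Set.Ioc 0 T))) →
        EEV.IsVelocitySpace Xh → EEV.IsPressureSpace Qh →
        (∀ j, u j 0 ∈ EEV.divFree D) →
        EEV.IsBESolution Xh Qh ν f γ μ Δt M u p →
        (∀ j, ∀ n ∈ Finset.Icc 1 M,
          ENNReal.ofReal Δt *
              eLpNorm (EEV.divg (EEV.fluct (fun i => u i n) j)) ⊤ (EEV.vol D) ^ 2
            ≤ ENNReal.ofReal (C * EEV.alpha D ν j)) →
        ∀ j,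
          ‖EEV.val (u j M)‖ ^ 2
            + EEV.alpha D ν j * Δt * ∑ n ∈ Finset.Icc 1 M, ‖EEV.grad (u j n)‖ ^ 2
            + 2 * γ * Δt * ∑ n ∈ Finset.Icc 1 M, ‖EEV.divg (u j n)‖ ^ 2
          ≤ ‖EEV.val (u j 0)‖ ^ 2
            + EEV.nuBarMin D ν * Δt * ‖EEV.grad (u j 0)‖ ^ 2
            + 2 * Δt / EEV.alpha D ν j *
              ∑ n ∈ Finset.Icc 1 M, EEV.negNorm (f j (n * Δt)) ^ 2 := by
  obtain ⟨P, hP, hPoinc⟩ := EEV.exists_norm_val_le (by omega) hDo.measurableSet hDb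
  -- with `P` the Poincaré constant, this choice lets the viscosity absorb the divergence term
  refine ⟨1 / P ^ 2, by positivity, ?_⟩
  intro J ν T τ γ μ M f Xh Qh u p _ hτ _ _ hμ hν hα _ hX _ hu0 hs hcfl j
  have hα' := hα j
  have hKex : ∀ n < M, ∃ K : ℝ,
      (∀ᵐ x ∂EEV.vol D, ‖EEV.divg (EEV.fluct (fun i => u i n) j) x‖ ≤ K) ∧
        τ * K ^ 2 ≤ 1 / P ^ 2 * EEV.alpha D ν j := by
    intro n hn
    rcases Nat.eq_zero_or_pos n with rfl | hn0
    · -- the condition on the divergence does not cover `n = 0`, where the fluctuation is solenoidal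
      have h0 := EEV.divg_fluct_eq_zero (u := fun i => u i 0)
        (fun i => EEV.divg_eq_zero_of_mem_divFree hDb (hu0 i)) j
      refine ⟨0, ?_, ?_⟩
      · rw [h0]
        filter_upwards [Lp.coeFn_zero ℝ 2 (EEV.vol D)] with x hx
        rw [hx]
        simp
      · rw [zero_pow two_ne_zero, mul_zero]
        positivity
    · exact EEV.exists_ae_bound hτ (by positivity) (hcfl j n (Finset.mem_Icc.mpr ⟨hn0, hn.le⟩))
  have hsum : ∀ n ≤ M,
      ‖EEV.val (u j n)‖ ^ 2
          + τ * (EEV.nuBarMin D ν - EEV.alpha D ν j) * ‖EEV.grad (u j n)‖ ^ 2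
          + EEV.alpha D ν j * τ * ∑ k ∈ Finset.Icc 1 n, ‖EEV.grad (u j k)‖ ^ 2
          + 2 * γ * τ * ∑ k ∈ Finset.Icc 1 n, ‖EEV.divg (u j k)‖ ^ 2
        ≤ ‖EEV.val (u j 0)‖ ^ 2
          + τ * (EEV.nuBarMin D ν - EEV.alpha D ν j) * ‖EEV.grad (u j 0)‖ ^ 2
          + 2 * τ / EEV.alpha D ν j *
            ∑ k ∈ Finset.Icc 1 n, EEV.negNorm (f j (k * τ)) ^ 2 := by
    intro n
    induction n with
    | zero => simp
    | succ n ih =>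
      intro hn
      obtain ⟨K, hK, hKτ⟩ := hKex n hn
      have hstep := hs.energy_step hX hν hτ hμ hP hPoinc hα' hn hK hKτ
      have := ih (Nat.le_of_succ_le hn)
      rw [Finset.sum_Icc_succ_top (by omega), Finset.sum_Icc_succ_top (by omega),
        Finset.sum_Icc_succ_top (by omega)]
      linarith
  have hM := hsum M le_rfl
  have hN : 0 ≤ EEV.nuBarMin D ν - EEV.alpha D ν j := by
    rw [EEV.alpha, sub_sub_cancel]
    exact ENNReal.toReal_nonneg
  -- dropped on the left, and needed to replace the weight by `ν̄_min` on the right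
  have h1 : 0 ≤ τ * (EEV.nuBarMin D ν - EEV.alpha D ν j) * ‖EEV.grad (u j M)‖ ^ 2 := by positivity
  have h2 : 0 ≤ τ * EEV.alpha D ν j * ‖EEV.grad (u j 0)‖ ^ 2 := by positivity
  linarith
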